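/- Let $G$ be a Hausdorff, locally compact, second countable, unimodular topological group with centre $Z$, and let $\mu$ be a Haar measure on $G$. Let $X=G/Z$ be the quotient group, $\alpha$ a Haar measure on $X$, and $s:X\to G$ a Borel section of the canonical projection $p:G\to X$. Let $\chi:Z\to\mathbb T$ be a continuous character of $Z$. Let $\mathcal H^\chi$ be the Hilbert space of $\mu$-equivalence classes of measurable functions $f:G\to\mathbb C$ such that $f(gh)=\chi(h^{-1})f(g)$ for all $g\in G$, $h\in Z$ and $f\circ s\in L^2(X,\alpha)$, with scalar product $\langle f_1,f_2\rangle=\int_X\overline{f_1(s(x))}\,f_2(s(x))\,d\alpha(x)$. Let $l$ be the unitary representation of $G$ on $\mathcal H^\chi$ given by $(l(a)f)(g)=f(a^{-1}g)$. Let $V$ be a closed $l$-invariant subspace of $\mathcal H^\chi$ on which $l$ acts irreducibly, and let $\sigma$ be the restriction of $l$ to $V$. For $u,v\in V$ let $c_{u,v}(g)=\langle\sigma(g)u,v\rangle$, $g\in G$, be the corresponding coefficient of $\sigma$. Then for all $u,v\in V$ the function $c_{u,v}$ is measurable, satisfies $c_{u,v}(gh)=\chi(h^{-1})c_{u,v}(g)$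 for all $g\in G$, $h\in Z$, and $c_{u,v}\circ s\in L^2(X,\alpha)$, so that it defines an element of $\mathcal H^\chi$; and $V$ is contained in the closed linear span $$M(\sigma)=\overline{\operatorname{span}}\,\{c_{u,v}\mid u,v\in V\}\subset\mathcal H^\chi .$$ -/

import Mathlib

open MeasureTheory
open scoped ENNReal

set_option linter.unusedSectionVars false

noncomputable section

namespace CentralInduction

/-! ### The group `G`, its centre `Z`, and the quotient `X = G ⧸ Z` -/

section Group

variable {G : Type*} [Group G] [TopologicalSpace G] [IsTopologicalGroup G]

instance isClosed_center [T2Space G] : IsClosed (Subgroup.center G : Set G) := by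
  rw [Subgroup.coe_center, ← Set.centralizer_univ]
  exact Set.isClosed_centralizer _

theorem polishSpace_of_locallyCompact (G : Type*) [Group G] [TopologicalSpace G]
    [IsTopologicalGroup G] [T2Space G] [LocallyCompactSpace G] [SecondCountableTopology G] :
    PolishSpace G := by
  let : UniformSpace G := IsTopologicalGroup.rightUniformSpace G
  have : IsRightUniformGroup G := ⟨rfl⟩
  have : CompleteSpace G := IsRightUniformGroup.completeSpace_of_weaklyLocallyCompactSpace
  have : (uniformity G).IsCountablyGenerated := by
    rw [uniformity_eq_comap_nhds_one]
    infer_instance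
  infer_instance

instance borelSpace_quotient_center [T2Space G] [LocallyCompactSpace G]
    [SecondCountableTopology G] [MeasurableSpace G] [BorelSpace G] :
    BorelSpace (G ⧸ Subgroup.center G) := by
  have := polishSpace_of_locallyCompact G
  infer_instance

end Group

/-- A Borel section `s : G ⧸ Z → G` of the canonical projection, `Z` being the centre of `G`. -/
structure BorelSection (G : Type*) [Group G] [MeasurableSpace G] where
  toFun : G ⧸ Subgroup.center G → G
  measurable_toFun : Measurable toFun
  mk_toFun : ∀ x : G ⧸ Subgroup.center G, (toFun x : G ⧸ Subgroup.center G) = x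

/-! ### Unitary representations on complex inner product spaces -/

section Rep

variable {G : Type*} [Group G] {E : Type*} [NormedAddCommGroup E] [InnerProductSpace ℂ E]

/-- `π` is (topologically) irreducible: the space is nonzero, and the only closed invariant
subspaces are `0` and the whole space. -/
def IsIrreducible (π : G →* (E ≃ₗᵢ[ℂ] E)) : Prop :=
  Nontrivial E ∧ ∀ W : Submodule ℂ E, IsClosed (W : Set E) →
    (∀ g : G, ∀ w ∈ W, π g w ∈ W) → W = ⊥ ∨ W = ⊤

/-- The coefficient `c_{u,v}(g) = ⟨π(g) u, v⟩`; the inner product is conjugate-linear in its first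
argument. -/
def coefficient (π : G →* (E ≃ₗᵢ[ℂ] E)) (u v : E) : G → ℂ :=
  fun g => inner ℂ (π g u) v

/-- The restriction of a unitary representation to an invariant subspace. -/
def restrict (π : G →* (E ≃ₗᵢ[ℂ] E)) (V : Submodule ℂ E)
    (hV : ∀ g : G, ∀ v ∈ V, π g v ∈ V) : G →* (V ≃ₗᵢ[ℂ] V) where
  toFun g :=
    { toFun := fun v => ⟨π g v, hV g v v.2⟩
      invFun := fun v => ⟨π g⁻¹ v, hV g⁻¹ v v.2⟩
      map_add' := fun v w => by ext; simp
      map_smul' := fun c v => by ext; simp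
      left_inv := fun v => by
        ext
        change (π g⁻¹ * π g) (v : E) = v
        rw [← map_mul]; simp
      right_inv := fun v => by
        ext
        change (π g * π g⁻¹) (v : E) = v
        rw [← map_mul]; simp
      norm_map' := fun v => (π g).norm_map v }
  map_one' := by ext v; simp
  map_mul' g h := by ext v; simp

@[simp]
theorem coe_restrict_apply (π : G →* (E ≃ₗᵢ[ℂ] E)) (V : Submodule ℂ E)
    (hV : ∀ g : G, ∀ v ∈ V, π g v ∈ V) (g : G) (v : V) :
    (restrict π V hV g v : E) = π g v := rfl

end Rep

/-! ### The induced Hilbert space and the induced representation -/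

section Induced

variable {G : Type*} [Group G] [TopologicalSpace G] [IsTopologicalGroup G] [T2Space G]
  [LocallyCompactSpace G] [SecondCountableTopology G] [MeasurableSpace G] [BorelSpace G]

/-- The measurable functions `f : G → ℂ` with `f(gh) = χ(h⁻¹) f(g)` for `g ∈ G`, `h ∈ Z`, and
`f ∘ s ∈ L²(X, α)`, before passing to equivalence classes. -/
def inducedFunctions (χ : Subgroup.center G →ₜ* Circle) (s : BorelSection G)
    (α : Measure (G ⧸ Subgroup.center G)) : Submodule ℂ (G → ℂ) where
  carrier := {f | Measurable f ∧
    (∀ (g : G) (h : Subgroup.center G), f (g * h) = (χ h⁻¹ : ℂ) * f g) ∧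
    MemLp (fun x => f (s.toFun x)) 2 α}
  zero_mem' := ⟨measurable_const, by simp, by simp⟩
  add_mem' := fun {f f'} hf hf' => ⟨hf.1.add hf'.1,
    fun g h => by simp only [Pi.add_apply, hf.2.1 g h, hf'.2.1 g h, mul_add],
    hf.2.2.add hf'.2.2⟩
  smul_mem' := fun c f hf => ⟨hf.1.const_smul c,
    fun g h => by simp only [Pi.smul_apply, smul_eq_mul, hf.2.1 g h]; ring,
    hf.2.2.const_smul c⟩

variable {χ : Subgroup.center G →ₜ* Circle} {s : BorelSection G} {μ : Measure G}
  {α : Measure (G ⧸ Subgroup.center G)}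

theorem norm_apply_section {f : G → ℂ} (hf : f ∈ inducedFunctions χ s α) (g : G) :
    ‖f (s.toFun (g : G ⧸ Subgroup.center G))‖ = ‖f g‖ := by
  have h : (s.toFun (g : G ⧸ Subgroup.center G))⁻¹ * g ∈ Subgroup.center G :=
    QuotientGroup.eq.1 (s.mk_toFun g)
  have := hf.2.1 (s.toFun (g : G ⧸ Subgroup.center G)) ⟨_, h⟩
  simp only [mul_inv_cancel_left] at this
  rw [this, norm_mul, Circle.norm_coe, one_mul]

/-- A Borel subset of `X` is null if and only if its inverse image in `G` is null. -/
theorem ae_quotient_iff [μ.IsHaarMeasure] [α.IsHaarMeasure] {E : G ⧸ Subgroup.center G → Prop}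
    (hE : MeasurableSet {x | E x}) :
    (∀ᵐ g : G ∂μ, E (g : G ⧸ Subgroup.center G)) ↔ ∀ᵐ x ∂α, E x := by
  have hm : Measurable (fun q : G × (G ⧸ Subgroup.center G) =>
      (q.1 : G ⧸ Subgroup.center G) * q.2) :=
    (QuotientGroup.continuous_mk.measurable.comp measurable_fst).mul measurable_snd
  have key := Measure.ae_ae_comm (μ := μ) (ν := α)
    (p := fun g x => E ((g : G ⧸ Subgroup.center G) * x)) (hm hE)
  have h1 : ∀ g : G, (∀ᵐ x ∂α, E ((g : G ⧸ Subgroup.center G) * x)) ↔ ∀ᵐ x ∂α, E x := by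
    intro g
    have := measure_preimage_mul α (g : G ⧸ Subgroup.center G) {x | ¬ E x}
    rw [ae_iff, ae_iff, ← this]
    rfl
  have h2 : ∀ x : G ⧸ Subgroup.center G,
      (∀ᵐ g : G ∂μ, E ((g : G ⧸ Subgroup.center G) * x)) ↔
        ∀ᵐ g : G ∂μ, E (g : G ⧸ Subgroup.center G) := by
    intro x
    obtain ⟨k, rfl⟩ := QuotientGroup.mk_surjective x
    have := measure_mul_right_null μ (s := {g : G | ¬ E (g : G ⧸ Subgroup.center G)}) k
    rw [ae_iff, ae_iff, ← this]
    rfl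
  simp only [h1, h2] at key
  have : (ae μ).NeBot := inferInstance
  have : (ae α).NeBot := inferInstance
  simpa using key.symm

theorem ae_zero_iff [μ.IsHaarMeasure] [α.IsHaarMeasure] {f : G → ℂ}
    (hf : f ∈ inducedFunctions χ s α) :
    f =ᵐ[μ] 0 ↔ (fun x => f (s.toFun x)) =ᵐ[α] 0 := by
  rw [Filter.EventuallyEq, Filter.EventuallyEq, ← ae_quotient_iff (μ := μ)]
  · refine Filter.eventually_congr (Filter.Eventually.of_forall fun g => ?_)
    rw [Pi.zero_apply, Pi.zero_apply, ← norm_eq_zero, ← norm_apply_section hf g, norm_eq_zero]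
  · exact (hf.1.comp s.measurable_toFun) (measurableSet_singleton 0)

variable (χ s μ α) in
/-- The functions that vanish `μ`-almost everywhere. -/
def nullFunctions : Submodule ℂ (inducedFunctions χ s α) where
  carrier := {f : inducedFunctions χ s α | (f : G → ℂ) =ᵐ[μ] 0}
  zero_mem' := Filter.EventuallyEq.refl (ae μ) (0 : G → ℂ)
  add_mem' := fun {f f'} hf hf' => by
    change ((f : G → ℂ) + (f' : G → ℂ)) =ᵐ[μ] 0
    filter_upwards [show (f : G → ℂ) =ᵐ[μ] 0 from hf,
      show (f' : G → ℂ) =ᵐ[μ] 0 from hf'] with g hg hg'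
    simp only [Pi.add_apply, hg, hg', Pi.zero_apply, add_zero]
  smul_mem' := fun c f hf => by
    change (c • (f : G → ℂ)) =ᵐ[μ] 0
    filter_upwards [show (f : G → ℂ) =ᵐ[μ] 0 from hf] with g hg
    simp only [Pi.smul_apply, hg, Pi.zero_apply, smul_zero]

variable (χ s μ α) in
/-- The space `H^χ` of `μ`-equivalence classes of functions in `inducedFunctions χ s α`. -/
def InducedSpace : Type _ := inducedFunctions χ s α ⧸ nullFunctions χ s μ α

instance : AddCommGroup (InducedSpace χ s μ α) :=
  inferInstanceAs (AddCommGroup (inducedFunctions χ s α ⧸ nullFunctions χ s μ α))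

instance : Module ℂ (InducedSpace χ s μ α) :=
  inferInstanceAs (Module ℂ (inducedFunctions χ s α ⧸ nullFunctions χ s μ α))

variable (χ s μ α) in
/-- The equivalence class of a function. -/
def toInduced : inducedFunctions χ s α →ₗ[ℂ] InducedSpace χ s μ α :=
  (nullFunctions χ s μ α).mkQ

theorem toInduced_surjective : Function.Surjective (toInduced χ s μ α) :=
  Submodule.mkQ_surjective _

theorem toInduced_eq_zero_iff {f : inducedFunctions χ s α} :
    toInduced χ s μ α f = 0 ↔ (f : G → ℂ) =ᵐ[μ] 0 :=
  Submodule.Quotient.mk_eq_zero _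

theorem toInduced_eq_iff {f f' : inducedFunctions χ s α} :
    toInduced χ s μ α f = toInduced χ s μ α f' ↔ (f : G → ℂ) =ᵐ[μ] f' := by
  rw [← sub_eq_zero, ← map_sub, toInduced_eq_zero_iff]
  exact Filter.eventuallyEq_iff_sub.symm

variable (χ s α) in
/-- `f ↦ f ∘ s` on functions. -/
def compSection : inducedFunctions χ s α →ₗ[ℂ] Lp ℂ 2 α where
  toFun f := f.2.2.2.toLp _
  map_add' _ _ := rfl
  map_smul' _ _ := rfl

theorem compSection_eq_zero_iff [μ.IsHaarMeasure] [α.IsHaarMeasure]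
    (f : inducedFunctions χ s α) : compSection χ s α f = 0 ↔ (f : G → ℂ) =ᵐ[μ] 0 := by
  rw [ae_zero_iff f.2]
  exact (MemLp.toLp_eq_toLp_iff f.2.2.2 MemLp.zero).trans Iff.rfl

variable (χ s μ α) in
/-- `f ↦ f ∘ s` on equivalence classes. -/
def toL2 [μ.IsHaarMeasure] [α.IsHaarMeasure] : InducedSpace χ s μ α →ₗ[ℂ] Lp ℂ 2 α :=
  (nullFunctions χ s μ α).liftQ (compSection χ s α)
    fun f hf => (compSection_eq_zero_iff (μ := μ) f).2 hf

theorem toL2_toInduced [μ.IsHaarMeasure] [α.IsHaarMeasure] (f : inducedFunctions χ s α) :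
    toL2 χ s μ α (toInduced χ s μ α f) = compSection χ s α f := rfl

theorem toL2_eq_zero [μ.IsHaarMeasure] [α.IsHaarMeasure] (F : InducedSpace χ s μ α)
    (hF : toL2 χ s μ α F = 0) : F = 0 := by
  obtain ⟨f, rfl⟩ := toInduced_surjective F
  rw [toL2_toInduced, compSection_eq_zero_iff (μ := μ)] at hF
  exact toInduced_eq_zero_iff.2 hF

/-- The scalar product of `H^χ`; see `inner_toInduced` for the explicit integral. -/
@[reducible]
def innerCore [μ.IsHaarMeasure] [α.IsHaarMeasure] :
    InnerProductSpace.Core ℂ (InducedSpace χ s μ α) where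
  inner F F' := inner ℂ (toL2 χ s μ α F) (toL2 χ s μ α F')
  conj_inner_symm F F' := inner_conj_symm _ _
  re_inner_nonneg F := inner_self_nonneg
  add_left F F' F'' := by simp only [map_add, inner_add_left]
  smul_left F F' c := by simp only [map_smul, inner_smul_left]
  definite F hF := toL2_eq_zero F (inner_self_eq_zero.1 hF)

instance [μ.IsHaarMeasure] [α.IsHaarMeasure] : NormedAddCommGroup (InducedSpace χ s μ α) :=
  InnerProductSpace.Core.toNormedAddCommGroup (𝕜 := ℂ) (cd := innerCore)

instance [μ.IsHaarMeasure] [α.IsHaarMeasure] : InnerProductSpace ℂ (InducedSpace χ s μ α) :=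
  InnerProductSpace.ofCore innerCore.toCore

theorem inner_toInduced [μ.IsHaarMeasure] [α.IsHaarMeasure] (f f' : inducedFunctions χ s α) :
    inner ℂ (toInduced χ s μ α f) (toInduced χ s μ α f') =
      ∫ x, (starRingEnd ℂ) ((f : G → ℂ) (s.toFun x)) * (f' : G → ℂ) (s.toFun x) ∂α := by
  change inner ℂ (compSection χ s α f) (compSection χ s α f') = _
  rw [L2.inner_def]
  refine integral_congr_ae ?_
  filter_upwards [f.2.2.2.coeFn_toLp, f'.2.2.2.coeFn_toLp] with x hx hx'
  change inner ℂ ((f.2.2.2.toLp _ : Lp ℂ 2 α) x) ((f'.2.2.2.toLp _ : Lp ℂ 2 α) x) = _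
  rw [hx, hx', RCLike.inner_apply, mul_comm]

theorem norm_toInduced [μ.IsHaarMeasure] [α.IsHaarMeasure] (f : inducedFunctions χ s α) :
    ‖toInduced χ s μ α f‖ = (eLpNorm (fun x => (f : G → ℂ) (s.toFun x)) 2 α).toReal := by
  have h : ‖toInduced χ s μ α f‖ ^ 2 = ‖compSection χ s α f‖ ^ 2 := by
    rw [← inner_self_eq_norm_sq (𝕜 := ℂ), ← inner_self_eq_norm_sq (𝕜 := ℂ)]
    rfl
  rw [(pow_left_inj₀ (norm_nonneg _) (norm_nonneg _) two_ne_zero).1 h]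
  exact Lp.norm_toLp _ f.2.2.2

theorem eLpNorm_translate [α.IsHaarMeasure] {f : G → ℂ} (hf : f ∈ inducedFunctions χ s α) (a : G) :
    eLpNorm (fun x => f (a⁻¹ * s.toFun x)) 2 α = eLpNorm (fun x => f (s.toFun x)) 2 α := by
  have h : ∀ x, ‖f (a⁻¹ * s.toFun x)‖ =
      ‖((fun x => f (s.toFun x)) ∘ fun x => (a : G ⧸ Subgroup.center G)⁻¹ * x) x‖ := by
    intro x
    rw [← norm_apply_section hf, QuotientGroup.mk_mul, s.mk_toFun, QuotientGroup.mk_inv]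
    rfl
  rw [eLpNorm_congr_norm_ae (Filter.Eventually.of_forall h)]
  exact eLpNorm_comp_measurePreserving hf.2.2.1 (measurePreserving_mul_left α _)

variable (χ s α) in
/-- Left translation `(l(a)f)(g) = f(a⁻¹g)` on functions. -/
def leftTranslate [α.IsHaarMeasure] (a : G) :
    inducedFunctions χ s α →ₗ[ℂ] inducedFunctions χ s α where
  toFun f := ⟨fun g => (f : G → ℂ) (a⁻¹ * g), f.2.1.comp (measurable_const_mul a⁻¹),
    fun g h => by simpa only [mul_assoc] using f.2.2.1 (a⁻¹ * g) h,
    (f.2.1.comp ((measurable_const_mul a⁻¹).comp s.measurable_toFun)).aestronglyMeasurable,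
    (eLpNorm_translate f.2 a).trans_lt f.2.2.2.2⟩
  map_add' _ _ := rfl
  map_smul' _ _ := rfl

theorem leftTranslate_ae [μ.IsHaarMeasure] [α.IsHaarMeasure] (a : G)
    {f : inducedFunctions χ s α} (hf : (f : G → ℂ) =ᵐ[μ] 0) :
    (leftTranslate χ s α a f : G → ℂ) =ᵐ[μ] 0 :=
  (measurePreserving_mul_left μ a⁻¹).quasiMeasurePreserving.ae_eq hf

variable (χ s μ α) in
/-- Left translation on equivalence classes. -/
def translate [μ.IsHaarMeasure] [α.IsHaarMeasure] (a : G) :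
    InducedSpace χ s μ α →ₗ[ℂ] InducedSpace χ s μ α :=
  (nullFunctions χ s μ α).mapQ (nullFunctions χ s μ α) (leftTranslate χ s α a)
    fun _ hf => leftTranslate_ae a hf

theorem translate_toInduced [μ.IsHaarMeasure] [α.IsHaarMeasure] (a : G)
    (f : inducedFunctions χ s α) :
    translate χ s μ α a (toInduced χ s μ α f) =
      toInduced χ s μ α (leftTranslate χ s α a f) := rfl

theorem translate_mul [μ.IsHaarMeasure] [α.IsHaarMeasure] (a b : G) (F : InducedSpace χ s μ α) :
    translate χ s μ α (a * b) F = translate χ s μ α a (translate χ s μ α b F) := by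
  obtain ⟨f, rfl⟩ := toInduced_surjective F
  simp only [translate_toInduced]
  congr 1
  ext g
  simp [leftTranslate, mul_assoc]

theorem translate_one [μ.IsHaarMeasure] [α.IsHaarMeasure] (F : InducedSpace χ s μ α) :
    translate χ s μ α 1 F = F := by
  obtain ⟨f, rfl⟩ := toInduced_surjective F
  simp only [translate_toInduced]
  congr 1
  ext g
  simp [leftTranslate]

theorem norm_translate [μ.IsHaarMeasure] [α.IsHaarMeasure] (a : G) (F : InducedSpace χ s μ α) :
    ‖translate χ s μ α a F‖ = ‖F‖ := by
  obtain ⟨f, rfl⟩ := toInduced_surjective F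
  rw [translate_toInduced, norm_toInduced, norm_toInduced]
  exact congrArg ENNReal.toReal (eLpNorm_translate f.2 a)

variable (χ s μ α) in
/-- The unitary representation `l` of `G` on `H^χ`, `(l(a)f)(g) = f(a⁻¹g)`. -/
def inducedRep [μ.IsHaarMeasure] [α.IsHaarMeasure] :
    G →* (InducedSpace χ s μ α ≃ₗᵢ[ℂ] InducedSpace χ s μ α) where
  toFun a :=
    { toLinearEquiv := LinearEquiv.ofLinearMap (translate χ s μ α a) (translate χ s μ α a⁻¹)
        (by ext F; simp [← translate_mul, translate_one])
        (by ext F; simp [← translate_mul, translate_one])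
      norm_map' := norm_translate a }
  map_one' := by ext F; exact translate_one F
  map_mul' a b := by ext F; exact translate_mul a b F

theorem inducedRep_toInduced [μ.IsHaarMeasure] [α.IsHaarMeasure] (a : G)
    (f : inducedFunctions χ s α) :
    inducedRep χ s μ α a (toInduced χ s μ α f) =
      toInduced χ s μ α (leftTranslate χ s α a f) := rfl

variable (χ s μ α) in
/-- `M(π)`: the closed linear span in `H^χ` of the classes of the coefficients `c_{u,v}` of `π`. -/
def coefficientSpace [μ.IsHaarMeasure] [α.IsHaarMeasure]
    {E : Type*} [NormedAddCommGroup E] [InnerProductSpace ℂ E] (π : G →* (E ≃ₗᵢ[ℂ] E)) :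
    Submodule ℂ (InducedSpace χ s μ α) :=
  (Submodule.span ℂ {F : InducedSpace χ s μ α | ∃ u v : E,
    ∃ h : coefficient π u v ∈ inducedFunctions χ s α,
      F = toInduced χ s μ α ⟨coefficient π u v, h⟩}).topologicalClosure

end Induced

end CentralInduction

end

/-!
The proof has two independent halves, both resting on Young's inequality modulo the centre `Z`.

Since `G` is unimodular, so is `X = G ⧸ Z` (`isMulRightInvariant_quotient_center`). Hence, if `f` is
a covariant function that is integrable modulo `Z`, the map `v ↦ c_{f,v}`, a convolution with the
adjoint of `f`, is bounded on `H^χ` with norm at most `‖f‖₁` (`norm_coefficient_le`). Projecting `f`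
orthogonally to `V` does not change `c_{f,v}` for `v ∈ V`, so all coefficients `c_{u,v}` with `u` in
a dense subspace of `V` (`dense_integrableProjections`) lie in `H^χ`.

*Square integrability.* For such a `u`, the map `v ↦ c_{u,v}` intertwines two unitary
representations, so by Schur's lemma `‖c_{u,v}‖² = λ_u ‖v‖²` (`exists_norm_sq_coefficient_eq`).
As inversion preserves the measure of `X`, `‖c_{u,v}‖ = ‖c_{v,u}‖`, which forces `λ_u` to be a
constant multiple of `‖u‖²` (`exists_eLpNorm_coefficient_le`). Fatou's lemma extends the resulting
bound to every `u ∈ V` (`coefficient_mem_of_isIrreducible`).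

*Density.* Let `v ∈ V`, and let `w` be orthogonal to `M(σ)`. By Fubini's theorem
`⟨w, c_{f,v}⟩` is the integral over `X` of the conjugate of `f` against `a ↦ ⟨w, R(a) v⟩`, where `R`
is right translation (`inner_coefficient_eq`). It vanishes for all integrable `f`, so
`⟨w, R(a) v⟩ = 0` for almost all `a`. Because `H^χ` is separable, some `a` works for all `w` at once,
whence `R(a) v ∈ M(σ)`; and `M(σ)` is invariant under right translations because
`c_{u,v}(ga) = c_{σ(a)u,v}(g)`. So `v ∈ M(σ)` (`le_coefficientSpace`).
-/

noncomputable section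

namespace CentralInduction

/-! ### Unimodularity of the quotient by the centre -/

section Unimodular

variable {G : Type*} [Group G] [TopologicalSpace G] [IsTopologicalGroup G] [T2Space G]
  [LocallyCompactSpace G] [SecondCountableTopology G] [MeasurableSpace G] [BorelSpace G]

/-- A left Haar measure on `G ⧸ Z` is right invariant as soon as `G` is unimodular. By Weil's
integration formula, averaging over `Z` sends the Haar integral on `G` to the Haar integral on
`G ⧸ Z`; since `Z` is central, averaging commutes with right translations, so that the right
translates of one average of positive integral all have the same integral. -/
theorem isMulRightInvariant_quotient_center (μ : Measure G) [μ.IsHaarMeasure]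
    [μ.IsMulRightInvariant] (α : Measure (G ⧸ Subgroup.center G)) [α.IsHaarMeasure] :
    α.IsMulRightInvariant := by
  have H := TopologicalGroup.IsSES.ofClosedSubgroup (Subgroup.center G) isClosed_center
  have : LocallyCompactSpace (Subgroup.center G) :=
    (isClosed_center (G := G)).isClosedEmbedding_subtypeVal.locallyCompactSpace
  let β : Measure (Subgroup.center G) := Measure.haar
  -- the Haar measure on `G` defined by Weil's formula, necessarily a multiple of `μ`
  let ν := H.inducedMeasure β α
  have hν : ν = Measure.haarScalarFactor ν μ • μ := Measure.isMulLeftInvariant_eq_smul ν μ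
  obtain ⟨⟨φ, φcont⟩, φcomp, φnonneg, φone⟩ :
    ∃ f : C(G, ℝ), HasCompactSupport f ∧ 0 ≤ f ∧ f 1 ≠ 0 := exists_continuous_nonneg_pos 1
  let f : CompactlySupportedContinuousMap G ℝ := ⟨⟨φ, φcont⟩, φcomp⟩
  have hνpos : 0 < ∫ g, f g ∂ν :=
    f.continuous.integral_pos_of_hasCompactSupport_nonneg_nonzero f.hasCompactSupport φnonneg φone
  -- `F` is the average of `f` over `Z`
  let F := H.pushforward β f
  have hF : ∫ x, F x ∂α = ∫ g, f g ∂ν := (H.integral_inducedMeasure β α f).symm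
  refine ⟨fun x => ?_⟩
  obtain ⟨a, rfl⟩ := QuotientGroup.mk_surjective x
  have hFa : ∫ x, F (x * (a : G ⧸ Subgroup.center G)) ∂α = ∫ x, F x ∂α := by
    let fa : CompactlySupportedContinuousMap G ℝ := f.comp (Homeomorph.mulRight a).toCocompactMap
    have h1 : ∀ x, F (x * (a : G ⧸ Subgroup.center G)) = H.pushforward β fa x := by
      intro x
      obtain ⟨b, rfl⟩ := QuotientGroup.mk_surjective x
      refine (H.pushforward_apply_apply β f (b * a)).trans
        (Eq.trans ?_ (H.pushforward_apply_apply β fa b).symm)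
      congr 1 with z
      change φ (b * a * z) = φ (b * z * a)
      rw [mul_assoc, mul_assoc, (Subgroup.mem_center_iff.1 z.2 a)]
    simp_rw [h1]
    rw [hF]
    refine (H.integral_inducedMeasure β α fa).symm.trans ?_
    change ∫ g, f (g * a) ∂ν = ∫ g, f g ∂ν
    rw [hν, integral_smul_nnreal_measure, integral_smul_nnreal_measure,
      integral_mul_right_eq_self]
  have hΔ := Measure.isMulLeftInvariant_eq_smul (Measure.map (· * (a : G ⧸ Subgroup.center G)) α) α
  set c := Measure.haarScalarFactor (Measure.map (· * (a : G ⧸ Subgroup.center G)) α) α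
  have h2 : ∫ x, F x ∂(Measure.map (· * (a : G ⧸ Subgroup.center G)) α) = ∫ x, F x ∂α := by
    exact (integral_map (measurable_mul_const _).aemeasurable
      F.continuous.aestronglyMeasurable).trans hFa
  rw [hΔ, integral_smul_nnreal_measure] at h2
  have hc : c = 1 := by
    have h3 : (c : ℝ) * ∫ x, F x ∂α = 1 * ∫ x, F x ∂α := by rw [one_mul]; exact h2
    exact_mod_cast mul_right_cancel₀ (hF ▸ hνpos.ne') h3
  rw [hΔ, hc, one_smul]

/-- A bi-invariant Haar measure is invariant under inversion: the inverted measure is `c` times the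
original one, and evaluating on a symmetric compact neighbourhood of `1` gives `c = 1`. -/
theorem isInvInvariant_of_isMulRightInvariant {X : Type*} [Group X] [TopologicalSpace X]
    [IsTopologicalGroup X] [LocallyCompactSpace X] [SecondCountableTopology X]
    [MeasurableSpace X] [BorelSpace X] (α : Measure X) [α.IsHaarMeasure]
    [α.IsMulRightInvariant] : α.IsInvInvariant := by
  have hΔ := Measure.isMulLeftInvariant_eq_smul α.inv α
  set c := Measure.haarScalarFactor α.inv α
  obtain ⟨K, hK, hK1⟩ := exists_compact_mem_nhds (1 : X)
  have hKK : IsCompact (K ∪ K⁻¹) := hK.union hK.inv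
  have hsymm : (K ∪ K⁻¹)⁻¹ = K ∪ K⁻¹ := by rw [Set.union_inv, inv_inv, Set.union_comm]
  have h0 : α (K ∪ K⁻¹) ≠ 0 :=
    (Measure.measure_pos_of_mem_nhds α (Filter.mem_of_superset hK1 Set.subset_union_left)).ne'
  have h1 : α.inv (K ∪ K⁻¹) = α (K ∪ K⁻¹) := by rw [Measure.inv_apply, hsymm]
  rw [hΔ, Measure.smul_apply, ENNReal.smul_def, smul_eq_mul] at h1
  have hc : (c : ℝ≥0∞) = 1 := by
    refine (ENNReal.mul_left_inj h0 hKK.measure_lt_top.ne).1 ?_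
    rw [h1, one_mul]
  refine ⟨?_⟩
  rw [hΔ, ENNReal.coe_eq_one.1 hc, one_smul]

end Unimodular

/-! ### Schur's lemma -/

section Schur

variable {G : Type*} [Group G] {E : Type*} [NormedAddCommGroup E] [InnerProductSpace ℂ E]

theorem inner_map_eq_inner_map_inv (π : G →* (E ≃ₗᵢ[ℂ] E)) (a : G) (x y : E) :
    inner ℂ (π a x) y = inner ℂ x (π a⁻¹ y) := by
  have h : π a (π a⁻¹ y) = y := by
    change (π a * π a⁻¹) y = y
    rw [← map_mul, mul_inv_cancel, map_one]
    rfl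
  rw [← (π a).inner_map_map x, h]

theorem coefficient_swap (π : G →* (E ≃ₗᵢ[ℂ] E)) (u v : E) (g : G) :
    coefficient π v u g = (starRingEnd ℂ) (coefficient π u v g⁻¹) := by
  rw [coefficient, coefficient, inner_map_eq_inner_map_inv, inner_conj_symm]

/-- Schur's lemma: two distinct points of the spectrum would be separated by continuous functions
`f`, `g` with `f g = 0`, and then the kernel of `f(A)` would be a proper nonzero closed invariant
subspace. -/
theorem IsIrreducible.exists_eq_smul_of_isSelfAdjoint [CompleteSpace E]
    {π : G →* (E ≃ₗᵢ[ℂ] E)} (hπ : IsIrreducible π) {A : E →L[ℂ] E} (hA : IsSelfAdjoint A)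
    (hcomm : ∀ g v, A (π g v) = π g (A v)) : ∃ c : ℝ, ∀ v, A v = (c : ℂ) • v := by
  have := hπ.1
  have hzero : ∀ f g : ℝ → ℝ, Continuous f → Continuous g → (∀ x, f x * g x = 0) →
      cfc f A = 0 ∨ cfc g A = 0 := by
    intro f g hf hg hfg
    have hmul : cfc f A * cfc g A = 0 := by
      rw [← cfc_mul f g A hf.continuousOn hg.continuousOn]
      simp only [hfg]
      exact cfc_const_zero ℝ A
    have hfcomm : ∀ a v, cfc f A (π a v) = π a (cfc f A v) := by
      intro a v
      have h : Commute A ((π a).toContinuousLinearEquiv : E →L[ℂ] E) := by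
        ext v
        exact hcomm a v
      exact congrArg (fun T : E →L[ℂ] E => T v) (h.cfc_real f).eq
    rcases hπ.2 (LinearMap.ker (cfc f A : E →L[ℂ] E).toLinearMap)
      (ContinuousLinearMap.isClosed_ker (cfc f A)) (fun a w hw => by
        rw [LinearMap.mem_ker] at hw ⊢
        change cfc f A w = 0 at hw
        change cfc f A (π a w) = 0
        rw [hfcomm, hw, map_zero]) with h | h
    · right
      ext v
      have : cfc g A v ∈ LinearMap.ker (cfc f A : E →L[ℂ] E).toLinearMap :=
        congrArg (fun T : E →L[ℂ] E => T v) hmul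
      rw [h] at this
      simpa using this
    · left
      ext v
      have : v ∈ LinearMap.ker (cfc f A : E →L[ℂ] E).toLinearMap := h ▸ Submodule.mem_top
      simpa using this
  obtain ⟨c, hc⟩ : (spectrum ℝ A).Nonempty :=
    ContinuousFunctionalCalculus.spectrum_nonempty A hA
  have hsub : ∀ d ∈ spectrum ℝ A, d = c := by
    intro d hd
    by_contra hne
    -- the bump functions at `c` and `d` with radius half the distance have disjoint supports
    let r := |d - c| / 2
    have hr : 0 < r := half_pos (abs_pos.2 (sub_ne_zero.2 hne))
    let f : ℝ → ℝ := fun x => max 0 (r - |x - c|)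
    let g : ℝ → ℝ := fun x => max 0 (r - |x - d|)
    have hf : Continuous f := by fun_prop
    have hg : Continuous g := by fun_prop
    have hfg : ∀ x, f x * g x = 0 := by
      intro x
      by_cases hx : r ≤ |x - c|
      · simp [f, max_eq_left (sub_nonpos.2 hx)]
      · have : r ≤ |x - d| := by
          have h1 : |d - c| ≤ |x - c| + |x - d| := by
            rw [add_comm, abs_sub_comm x d]
            exact abs_sub_le d x c
          have h2 : |d - c| = r + r := (add_halves _).symm
          linarith [not_le.1 hx]
        simp [g, max_eq_left (sub_nonpos.2 this)]
    have hspec : ∀ (h : ℝ → ℝ), Continuous h → ∀ x ∈ spectrum ℝ A, cfc h A = 0 → h x = 0 := by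
      intro h hh x hx h0
      have : h x ∈ spectrum ℝ (cfc h A) := by
        rw [cfc_map_spectrum (R := ℝ) h A hA hh.continuousOn]
        exact ⟨x, hx, rfl⟩
      rw [h0, spectrum.zero_eq] at this
      exact this
    rcases hzero f g hf hg hfg with h | h
    · have := hspec f hf c hc h
      simp only [f, sub_self, abs_zero, sub_zero, max_eq_right hr.le] at this
      exact hr.ne' this
    · have := hspec g hg d hd h
      simp only [g, sub_self, abs_zero, sub_zero, max_eq_right hr.le] at this
      exact hr.ne' this
  refine ⟨c, fun v => ?_⟩
  have h : A = cfc (fun _ : ℝ => c) A := by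
    conv_lhs => rw [← cfc_id ℝ A hA]
    exact cfc_congr fun x hx => hsub x hx
  rw [h, cfc_const c A hA, Algebra.algebraMap_eq_smul_one]
  exact (Complex.coe_smul c v).symm

/-- An intertwiner from an irreducible unitary representation is a multiple of an isometry. -/
theorem IsIrreducible.exists_norm_sq_eq [CompleteSpace E] {F : Type*}
    [NormedAddCommGroup F] [InnerProductSpace ℂ F] [CompleteSpace F]
    {π : G →* (E ≃ₗᵢ[ℂ] E)} (hπ : IsIrreducible π) (ρ : G →* (F ≃ₗᵢ[ℂ] F)) (T : E →L[ℂ] F)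
    (hT : ∀ g v, T (π g v) = ρ g (T v)) : ∃ c : ℝ, ∀ v, ‖T v‖ ^ 2 = c * ‖v‖ ^ 2 := by
  -- `A = T†T` is self-adjoint and commutes with `π`
  let A : E →L[ℂ] E := (ContinuousLinearMap.adjoint T).comp T
  have hA : IsSelfAdjoint A := by
    rw [IsSelfAdjoint, ContinuousLinearMap.star_eq_adjoint, ContinuousLinearMap.adjoint_comp,
      ContinuousLinearMap.adjoint_adjoint]
  have hinner : ∀ v w, inner ℂ (A v) w = inner ℂ (T v) (T w) := fun v w =>
    ContinuousLinearMap.adjoint_inner_left T w (T v)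
  obtain ⟨c, hc⟩ := hπ.exists_eq_smul_of_isSelfAdjoint hA fun g v => by
    refine ext_inner_right ℂ fun w => ?_
    rw [hinner, hT, inner_map_eq_inner_map_inv, ← hT, ← hinner, inner_map_eq_inner_map_inv]
  refine ⟨c, fun v => ?_⟩
  have h := hinner v v
  rw [hc, inner_smul_left, inner_self_eq_norm_sq_to_K, inner_self_eq_norm_sq_to_K,
    Complex.conj_ofReal] at h
  apply Complex.ofReal_injective
  push_cast
  exact h.symm

end Schur

/-! ### Young's inequality for `L¹ * L²` -/

theorem eLpNorm_two_sq {X : Type*} [MeasurableSpace X] (α : Measure X) (f : X → ℂ) :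
    eLpNorm f 2 α ^ 2 = ∫⁻ x, ‖f x‖ₑ ^ 2 ∂α := by
  have h := eLpNorm_nnreal_pow_eq_lintegral (f := f) (μ := α) (p := 2) two_ne_zero
  simpa using h

/-- Cauchy-Schwarz for the product `a * b`, the weight `a` being shared evenly. -/
theorem lintegral_mul_sq_le {X : Type*} [MeasurableSpace X] (α : Measure X) {a b : X → ℝ≥0∞}
    (ha : Measurable a) (hb : Measurable b) :
    (∫⁻ x, a x * b x ∂α) ^ 2 ≤ (∫⁻ x, a x ∂α) * ∫⁻ x, a x * b x ^ 2 ∂α := by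
  have h := ENNReal.lintegral_mul_norm_pow_le (μ := α) (f := a) (g := fun x => a x * b x ^ 2)
    ha.aemeasurable (ha.mul (hb.pow_const 2)).aemeasurable (p := 1 / 2) (q := 1 / 2)
    (by norm_num) (by norm_num) (by norm_num)
  have hsq : ∀ t : ℝ≥0∞, (t ^ (1 / 2 : ℝ)) ^ 2 = t := fun t => by
    rw [← ENNReal.rpow_natCast, ← ENNReal.rpow_mul]; norm_num
  have h1 : ∀ x, a x ^ (1 / 2 : ℝ) * (a x * b x ^ 2) ^ (1 / 2 : ℝ) = a x * b x := fun x => by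
    rw [← ENNReal.mul_rpow_of_nonneg _ _ (by norm_num), ← mul_assoc, ← sq, ← mul_pow,
      ← ENNReal.rpow_natCast, ← ENNReal.rpow_mul]
    norm_num
  simp_rw [h1] at h
  calc (∫⁻ x, a x * b x ∂α) ^ 2 ≤ _ := pow_le_pow_left' h 2
    _ = _ := by rw [mul_pow, hsq, hsq]

/-- Young's inequality `‖b * a'‖₂ ≤ ‖a‖₁ ‖b‖₂` with `a'(x) = a(x⁻¹)`, for an inversion invariant Haar
measure. -/
theorem lintegral_convolution_sq_le {X : Type*} [Group X] [MeasurableSpace X] [MeasurableMul₂ X]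
    [MeasurableInv X] (α : Measure X) [SFinite α] [α.IsMulLeftInvariant] [α.IsInvInvariant]
    {a b : X → ℝ≥0∞} (ha : Measurable a) (hb : Measurable b) :
    ∫⁻ z, (∫⁻ x, a (z⁻¹ * x) * b x ∂α) ^ 2 ∂α ≤ (∫⁻ x, a x ∂α) ^ 2 * ∫⁻ x, b x ^ 2 ∂α := by
  have h1 : ∀ x, ∫⁻ z, a (z⁻¹ * x) ∂α = ∫⁻ z, a z ∂α := fun x => by
    have h := lintegral_mul_left_eq_self (μ := α) (fun z => a z⁻¹) x⁻¹
    simpa only [mul_inv_rev, inv_inv, lintegral_inv_eq_self a] using h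
  calc ∫⁻ z, (∫⁻ x, a (z⁻¹ * x) * b x ∂α) ^ 2 ∂α
      ≤ ∫⁻ z, (∫⁻ x, a x ∂α) * ∫⁻ x, a (z⁻¹ * x) * b x ^ 2 ∂α ∂α := by
        refine lintegral_mono fun z => ?_
        have := lintegral_mul_sq_le α (a := fun x => a (z⁻¹ * x)) 
          (ha.comp (measurable_const_mul _)) hb
        rwa [lintegral_mul_left_eq_self a] at this
    _ = (∫⁻ x, a x ∂α) * ∫⁻ z, ∫⁻ x, a (z⁻¹ * x) * b x ^ 2 ∂α ∂α := by
        refine lintegral_const_mul _ (Measurable.lintegral_prod_right' (f := fun q : X × X =>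
          a (q.1⁻¹ * q.2) * b q.2 ^ 2) ?_)
        fun_prop
    _ = (∫⁻ x, a x ∂α) * ∫⁻ x, ∫⁻ z, a (z⁻¹ * x) * b x ^ 2 ∂α ∂α := by
        rw [lintegral_lintegral_swap]
        exact Measurable.aemeasurable (by fun_prop)
    _ = (∫⁻ x, a x ∂α) * ∫⁻ x, (∫⁻ z, a z ∂α) * b x ^ 2 ∂α := by
        congr 1
        refine lintegral_congr fun x => ?_
        rw [lintegral_mul_const _ (by fun_prop), h1]
    _ = _ := by
        rw [lintegral_const_mul _ (by fun_prop), sq, mul_assoc]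

/-! ### Hilbert space structure of the induced space -/

section Induced

variable {G : Type*} [Group G] [TopologicalSpace G] [IsTopologicalGroup G] [T2Space G]
  [LocallyCompactSpace G] [SecondCountableTopology G] [MeasurableSpace G] [BorelSpace G]
  {χ : Subgroup.center G →ₜ* Circle} {s : BorelSection G} {μ : Measure G}
  {α : Measure (G ⧸ Subgroup.center G)}

theorem norm_toL2 [μ.IsHaarMeasure] [α.IsHaarMeasure] (F : InducedSpace χ s μ α) :
    ‖toL2 χ s μ α F‖ = ‖F‖ := by
  obtain ⟨f, rfl⟩ := toInduced_surjective F
  rw [norm_toInduced, toL2_toInduced]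
  exact Lp.norm_toLp _ f.2.2.2

/-- The covariant extension `g ↦ χ((s(p(g))⁻¹g)⁻¹) φ(p(g))` of a function `φ` on `G ⧸ Z`. -/
def extendCovariant (χ : Subgroup.center G →ₜ* Circle) (s : BorelSection G)
    (φ : G ⧸ Subgroup.center G → ℂ) (g : G) : ℂ :=
  (χ ⟨(s.toFun (g : G ⧸ Subgroup.center G))⁻¹ * g, QuotientGroup.eq.1 (s.mk_toFun g)⟩⁻¹ : ℂ) *
    φ (g : G ⧸ Subgroup.center G)

theorem extendCovariant_section (φ : G ⧸ Subgroup.center G → ℂ) (x : G ⧸ Subgroup.center G) :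
    extendCovariant χ s φ (s.toFun x) = φ x := by
  have h : (⟨(s.toFun ((s.toFun x : G) : G ⧸ Subgroup.center G))⁻¹ * s.toFun x,
      QuotientGroup.eq.1 (s.mk_toFun _)⟩ : Subgroup.center G) = 1 := by
    ext
    simp only [s.mk_toFun, inv_mul_cancel, Subgroup.coe_one]
  rw [extendCovariant, h, s.mk_toFun]
  simp

theorem measurable_extendCovariant {φ : G ⧸ Subgroup.center G → ℂ} (hφ : Measurable φ) :
    Measurable (extendCovariant χ s φ) := by
  have hp : Measurable (fun g : G => (g : G ⧸ Subgroup.center G)) :=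
    QuotientGroup.continuous_mk.measurable
  have hz : Measurable (fun g : G =>
      (⟨(s.toFun (g : G ⧸ Subgroup.center G))⁻¹ * g, QuotientGroup.eq.1 (s.mk_toFun g)⟩ :
        Subgroup.center G)) :=
    Measurable.subtype_mk ((s.measurable_toFun.comp hp).inv.mul measurable_id)
  have hχ : Measurable (fun z : Subgroup.center G => (χ z⁻¹ : ℂ)) :=
    (continuous_subtype_val.comp (χ.continuous_toFun.comp continuous_inv)).measurable
  exact (hχ.comp hz).mul (hφ.comp hp)

theorem extendCovariant_mul (φ : G ⧸ Subgroup.center G → ℂ) (g : G) (h : Subgroup.center G) :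
    extendCovariant χ s φ (g * h) = (χ h⁻¹ : ℂ) * extendCovariant χ s φ g := by
  have h0 : ((g * h : G) : G ⧸ Subgroup.center G) = g := QuotientGroup.mk_mul_of_mem g h.2
  have h1 : (⟨(s.toFun ((g * h : G) : G ⧸ Subgroup.center G))⁻¹ * (g * h),
      QuotientGroup.eq.1 (s.mk_toFun _)⟩ : Subgroup.center G) =
      ⟨(s.toFun (g : G ⧸ Subgroup.center G))⁻¹ * g, QuotientGroup.eq.1 (s.mk_toFun g)⟩ * h := by
    ext
    simp only [h0, Subgroup.coe_mul, mul_assoc]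
  rw [extendCovariant, h1, h0, extendCovariant, mul_inv_rev, map_mul, Circle.coe_mul, mul_assoc]

theorem extendCovariant_mem {φ : G ⧸ Subgroup.center G → ℂ} (hφ : Measurable φ)
    (hφ2 : MemLp φ 2 α) : extendCovariant χ s φ ∈ inducedFunctions χ s α :=
  ⟨measurable_extendCovariant hφ, extendCovariant_mul φ, by simpa only [extendCovariant_section]⟩

theorem toL2_surjective [μ.IsHaarMeasure] [α.IsHaarMeasure] :
    Function.Surjective (toL2 χ s μ α) := by
  intro φ
  obtain ⟨ψ, hψ, hφψ⟩ := Lp.aestronglyMeasurable φ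
  have hψ2 : MemLp ψ 2 α := (memLp_congr_ae hφψ).1 (Lp.memLp φ)
  refine ⟨toInduced χ s μ α ⟨_, extendCovariant_mem hψ.measurable hψ2⟩, ?_⟩
  rw [toL2_toInduced]
  have hmem := extendCovariant_mem (χ := χ) (s := s) hψ.measurable hψ2
  refine Lp.ext ((MemLp.coeFn_toLp hmem.2.2).trans ?_)
  simp only [extendCovariant_section]
  exact hφψ.symm

variable (χ s μ α) in
/-- The unitary isomorphism `f ↦ f ∘ s` of `H^χ` onto `L²(X, α)`. -/
def toL2Equiv [μ.IsHaarMeasure] [α.IsHaarMeasure] : InducedSpace χ s μ α ≃ₗᵢ[ℂ] Lp ℂ 2 α :=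
  LinearIsometryEquiv.ofSurjective ⟨toL2 χ s μ α, norm_toL2⟩ toL2_surjective

instance [μ.IsHaarMeasure] [α.IsHaarMeasure] : CompleteSpace (InducedSpace χ s μ α) :=
  (completeSpace_congr (e := (toL2Equiv χ s μ α).toEquiv)
    (toL2Equiv χ s μ α).isometry.isUniformEmbedding).2 inferInstance

instance [μ.IsHaarMeasure] [α.IsHaarMeasure] :
    SecondCountableTopology (InducedSpace χ s μ α) := by
  have : Fact ((2 : ℝ≥0∞) ≠ ∞) := ⟨ENNReal.ofNat_ne_top⟩
  exact (toL2Equiv χ s μ α).toHomeomorph.secondCountableTopology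

end Induced

section Integrable

variable {G : Type*} [Group G] [TopologicalSpace G] [IsTopologicalGroup G] [T2Space G]
  [LocallyCompactSpace G] [SecondCountableTopology G] [MeasurableSpace G] [BorelSpace G]
  {χ : Subgroup.center G →ₜ* Circle} {s : BorelSection G} {μ : Measure G}
  {α : Measure (G ⧸ Subgroup.center G)}

/-! ### Functions that are integrable modulo the centre -/

variable (χ s α) in
/-- The functions `f` of `inducedFunctions χ s α` such that `f ∘ s` is also in `L¹(X, α)`. -/
def integrableFunctions : Submodule ℂ (inducedFunctions χ s α) where
  carrier := {f | Integrable (fun x => (f : G → ℂ) (s.toFun x)) α}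
  zero_mem' := integrable_zero _ _ _
  add_mem' := fun hf hf' => Integrable.add hf hf'
  smul_mem' := fun c _ hf => Integrable.smul c hf

theorem indicator_section (E : Set (G ⧸ Subgroup.center G)) (k : G → ℂ)
    (x : G ⧸ Subgroup.center G) :
    ((fun g : G => (g : G ⧸ Subgroup.center G)) ⁻¹' E).indicator k (s.toFun x) =
      E.indicator (fun x => k (s.toFun x)) x := by
  have h : s.toFun x ∈ (fun g : G => (g : G ⧸ Subgroup.center G)) ⁻¹' E ↔ x ∈ E := by
    rw [Set.mem_preimage, s.mk_toFun]
  by_cases hx : x ∈ E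
  · rw [Set.indicator_of_mem (h.2 hx), Set.indicator_of_mem hx]
  · rw [Set.indicator_of_notMem (mt h.1 hx), Set.indicator_of_notMem hx]

theorem indicator_mem {k : G → ℂ} (hk : Measurable k)
    (hcov : ∀ (g : G) (h : Subgroup.center G), k (g * h) = (χ h⁻¹ : ℂ) * k g)
    {E : Set (G ⧸ Subgroup.center G)} (hE : MeasurableSet E)
    (hkE : MemLp (fun x => k (s.toFun x)) 2 (α.restrict E)) :
    ((fun g : G => (g : G ⧸ Subgroup.center G)) ⁻¹' E).indicator k ∈ inducedFunctions χ s α := by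
  refine ⟨hk.indicator (QuotientGroup.continuous_mk.measurable hE), fun g h => ?_, ?_⟩
  · have h0 : ((g * h : G) : G ⧸ Subgroup.center G) = g := QuotientGroup.mk_mul_of_mem g h.2
    by_cases hg : (g : G ⧸ Subgroup.center G) ∈ E
    · rw [Set.indicator_of_mem (by simpa only [Set.mem_preimage, h0] using hg),
        Set.indicator_of_mem (by simpa only [Set.mem_preimage] using hg), hcov]
    · rw [Set.indicator_of_notMem (by simpa only [Set.mem_preimage, h0] using hg),
        Set.indicator_of_notMem (by simpa only [Set.mem_preimage] using hg), mul_zero]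
  · simp_rw [indicator_section]
    exact (memLp_indicator_iff_restrict hE).2 hkE

/-- A covariant function that is locally square integrable modulo the centre and orthogonal to all
integrable functions vanishes; its own truncations serve as test functions. -/
theorem ae_eq_zero_of_forall_integrableFunctions [SigmaFinite α] {k : G → ℂ} (hk : Measurable k)
    (hcov : ∀ (g : G) (h : Subgroup.center G), k (g * h) = (χ h⁻¹ : ℂ) * k g)
    (hk2 : ∀ E : Set (G ⧸ Subgroup.center G), MeasurableSet E → α E < ∞ →
      MemLp (fun x => k (s.toFun x)) 2 (α.restrict E))
    (h : ∀ f ∈ integrableFunctions χ s α,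
      ∫ x, (starRingEnd ℂ) ((f : G → ℂ) (s.toFun x)) * k (s.toFun x) ∂α = 0) :
    ∀ᵐ x ∂α, k (s.toFun x) = 0 := by
  refine ae_of_forall_measure_lt_top_ae_restrict _ fun E hE hEfin => ?_
  have hkE := hk2 E hE hEfin
  have : IsFiniteMeasure (α.restrict E) := ⟨by simpa using hEfin⟩
  have h0 := h ⟨_, indicator_mem hk hcov hE hkE⟩ (by
    change Integrable (fun x => Set.indicator _ k (s.toFun x)) α
    simp_rw [indicator_section]
    exact (integrable_indicator_iff hE).2 (hkE.integrable one_le_two))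
  have h1 : ∀ x, (starRingEnd ℂ)
      (((fun g : G => (g : G ⧸ Subgroup.center G)) ⁻¹' E).indicator k (s.toFun x)) *
        k (s.toFun x) = E.indicator (fun x => ((‖k (s.toFun x)‖ ^ 2 : ℝ) : ℂ)) x := fun x => by
    rw [indicator_section]
    by_cases hx : x ∈ E
    · rw [Set.indicator_of_mem hx, Set.indicator_of_mem hx, Complex.conj_mul']
      push_cast; rfl
    · rw [Set.indicator_of_notMem hx, Set.indicator_of_notMem hx, map_zero, zero_mul]
  simp only [h1] at h0
  rw [integral_indicator hE, integral_complex_ofReal, Complex.ofReal_eq_zero,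
    integral_eq_zero_iff_of_nonneg (fun _ => sq_nonneg _) (hkE.integrable_norm_pow two_ne_zero)]
    at h0
  filter_upwards [h0] with x hx
  simpa using hx

theorem eq_zero_of_forall_inner_integrableFunctions [μ.IsHaarMeasure] [α.IsHaarMeasure]
    {F : InducedSpace χ s μ α}
    (h : ∀ f ∈ integrableFunctions χ s α, inner ℂ (toInduced χ s μ α f) F = 0) : F = 0 := by
  obtain ⟨k, rfl⟩ := toInduced_surjective F
  rw [toInduced_eq_zero_iff, ae_zero_iff k.2]
  exact ae_eq_zero_of_forall_integrableFunctions k.2.1 k.2.2.1 (fun E _ _ => k.2.2.2.restrict E)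
    fun f hf => (inner_toInduced f k).symm.trans (h f hf)

/-! ### Coefficients of the induced representation -/

variable [μ.IsHaarMeasure] [α.IsHaarMeasure]

theorem coefficient_toInduced (f f' : inducedFunctions χ s α) (g : G) :
    coefficient (inducedRep χ s μ α) (toInduced χ s μ α f) (toInduced χ s μ α f') g =
      ∫ x, (starRingEnd ℂ) ((f : G → ℂ) (g⁻¹ * s.toFun x)) * (f' : G → ℂ) (s.toFun x) ∂α :=
  inner_toInduced (leftTranslate χ s α g f) f'

theorem measurable_coefficient (u v : InducedSpace χ s μ α) :
    Measurable (coefficient (inducedRep χ s μ α) u v) := by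
  obtain ⟨f, rfl⟩ := toInduced_surjective u
  obtain ⟨f', rfl⟩ := toInduced_surjective v
  have hf := f.2.1
  have hf' := f'.2.1
  have hs := s.measurable_toFun
  have h : StronglyMeasurable (fun g : G => ∫ x, (starRingEnd ℂ)
      ((f : G → ℂ) (g⁻¹ * s.toFun x)) * (f' : G → ℂ) (s.toFun x) ∂α) := by
    refine StronglyMeasurable.integral_prod_right' (f := fun q : G × (G ⧸ Subgroup.center G) =>
      (starRingEnd ℂ) ((f : G → ℂ) (q.1⁻¹ * s.toFun q.2)) * (f' : G → ℂ) (s.toFun q.2)) ?_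
    refine Measurable.stronglyMeasurable (Measurable.mul ?_ (hf'.comp (hs.comp measurable_snd)))
    exact Complex.continuous_conj.measurable.comp
      (hf.comp (measurable_fst.inv.mul (hs.comp measurable_snd)))
  convert h.measurable using 1
  ext g
  exact coefficient_toInduced f f' g

theorem inducedRep_center (h : Subgroup.center G) (u : InducedSpace χ s μ α) :
    inducedRep χ s μ α (h : G) u = (χ h : ℂ) • u := by
  obtain ⟨f, rfl⟩ := toInduced_surjective u
  rw [inducedRep_toInduced, ← map_smul]
  congr 1
  ext g
  change (f : G → ℂ) ((h : G)⁻¹ * g) = (χ h : ℂ) * (f : G → ℂ) g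
  have hc : (h : G)⁻¹ * g = g * ((h⁻¹ : Subgroup.center G) : G) :=
    (Subgroup.mem_center_iff.1 (h⁻¹).2 g).symm
  rw [hc, f.2.2.1, inv_inv]

theorem coefficient_mul_center (u v : InducedSpace χ s μ α) (g : G) (h : Subgroup.center G) :
    coefficient (inducedRep χ s μ α) u v (g * h) =
      (χ h⁻¹ : ℂ) * coefficient (inducedRep χ s μ α) u v g := by
  have h1 : inducedRep χ s μ α (g * h) u =
      inducedRep χ s μ α g (inducedRep χ s μ α (h : G) u) := by
    rw [map_mul]; rfl
  rw [coefficient, coefficient, h1, inducedRep_center, map_smul, inner_smul_left, map_inv,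
    Circle.coe_inv_eq_conj]

theorem coefficient_mem_iff (u v : InducedSpace χ s μ α) :
    coefficient (inducedRep χ s μ α) u v ∈ inducedFunctions χ s α ↔
      eLpNorm (fun x => coefficient (inducedRep χ s μ α) u v (s.toFun x)) 2 α < ∞ :=
  ⟨fun h => h.2.2.2, fun h => ⟨measurable_coefficient u v, coefficient_mul_center u v,
    ((measurable_coefficient u v).comp s.measurable_toFun).aestronglyMeasurable, h⟩⟩

theorem enorm_apply_section (f : inducedFunctions χ s α) (g : G) :
    ‖(f : G → ℂ) (s.toFun (g : G ⧸ Subgroup.center G))‖ₑ = ‖(f : G → ℂ) g‖ₑ := by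
  rw [← ofReal_norm, ← ofReal_norm, norm_apply_section f.2]

variable [α.IsInvInvariant]

/-- Modulo the centre, a coefficient is the convolution of `f'` with the adjoint of `f`, so that
Young's inequality bounds its `L²`-norm. -/
theorem eLpNorm_coefficient_le (f f' : inducedFunctions χ s α) :
    eLpNorm (fun x => coefficient (inducedRep χ s μ α) (toInduced χ s μ α f)
      (toInduced χ s μ α f') (s.toFun x)) 2 α ≤
      (∫⁻ x, ‖(f : G → ℂ) (s.toFun x)‖ₑ ∂α) *
        eLpNorm (fun x => (f' : G → ℂ) (s.toFun x)) 2 α := by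
  refine (ENNReal.pow_le_pow_left_iff two_ne_zero).1 ?_
  rw [mul_pow, eLpNorm_two_sq, eLpNorm_two_sq]
  refine le_trans (lintegral_mono fun z => ?_)
    (lintegral_convolution_sq_le α (f.2.1.comp s.measurable_toFun).enorm
      (f'.2.1.comp s.measurable_toFun).enorm)
  refine pow_le_pow_left' ?_ 2
  rw [coefficient_toInduced]
  refine (enorm_integral_le_lintegral_enorm _).trans_eq (lintegral_congr fun x => ?_)
  rw [enorm_mul, RCLike.enorm_conj, ← enorm_apply_section f, QuotientGroup.mk_mul,
    QuotientGroup.mk_inv, s.mk_toFun, s.mk_toFun]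

theorem coefficient_mem_of_integrable {f : inducedFunctions χ s α}
    (hf : f ∈ integrableFunctions χ s α) (v : InducedSpace χ s μ α) :
    coefficient (inducedRep χ s μ α) (toInduced χ s μ α f) v ∈ inducedFunctions χ s α := by
  obtain ⟨f', rfl⟩ := toInduced_surjective v
  exact (coefficient_mem_iff _ _).2 ((eLpNorm_coefficient_le f f').trans_lt
    (ENNReal.mul_lt_top hf.2 f'.2.2.2.2))

theorem norm_coefficient_le {f : inducedFunctions χ s α}
    (hf : f ∈ integrableFunctions χ s α) (v : InducedSpace χ s μ α) :
    ‖toInduced χ s μ α ⟨_, coefficient_mem_of_integrable hf v⟩‖ ≤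
      (∫⁻ x, ‖(f : G → ℂ) (s.toFun x)‖ₑ ∂α).toReal * ‖v‖ := by
  obtain ⟨f', rfl⟩ := toInduced_surjective v
  rw [norm_toInduced, norm_toInduced, ← ENNReal.toReal_mul]
  exact ENNReal.toReal_mono (ENNReal.mul_lt_top hf.2 f'.2.2.2.2).ne (eLpNorm_coefficient_le f f')

theorem eLpNorm_coefficient_swap {u v : InducedSpace χ s μ α}
    (h : coefficient (inducedRep χ s μ α) u v ∈ inducedFunctions χ s α) :
    eLpNorm (fun x => coefficient (inducedRep χ s μ α) v u (s.toFun x)) 2 α =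
      eLpNorm (fun x => coefficient (inducedRep χ s μ α) u v (s.toFun x)) 2 α := by
  have h1 : ∀ x, ‖coefficient (inducedRep χ s μ α) v u (s.toFun x)‖ =
      ‖((fun x => coefficient (inducedRep χ s μ α) u v (s.toFun x)) ∘ Inv.inv) x‖ := fun x => by
    rw [coefficient_swap, RCLike.norm_conj, ← norm_apply_section h, QuotientGroup.mk_inv,
      s.mk_toFun]
    rfl
  rw [eLpNorm_congr_norm_ae (Filter.Eventually.of_forall h1)]
  exact eLpNorm_comp_measurePreserving h.2.2.1 (Measure.measurePreserving_inv α)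

theorem coefficient_swap_mem {u v : InducedSpace χ s μ α}
    (h : coefficient (inducedRep χ s μ α) u v ∈ inducedFunctions χ s α) :
    coefficient (inducedRep χ s μ α) v u ∈ inducedFunctions χ s α :=
  (coefficient_mem_iff v u).2 ((eLpNorm_coefficient_swap h).trans_lt h.2.2.2)

end Integrable

section SquareIntegrable

variable {G : Type*} [Group G] [TopologicalSpace G] [IsTopologicalGroup G] [T2Space G]
  [LocallyCompactSpace G] [SecondCountableTopology G] [MeasurableSpace G] [BorelSpace G]
  {χ : Subgroup.center G →ₜ* Circle} {s : BorelSection G} {μ : Measure G}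
  {α : Measure (G ⧸ Subgroup.center G)} [μ.IsHaarMeasure] [α.IsHaarMeasure]

/-! ### Square integrability of the coefficients of an irreducible subrepresentation -/

variable (V : Submodule ℂ (InducedSpace χ s μ α)) [CompleteSpace V]

/-- The projections to `V` of the classes of functions that are integrable modulo the centre. -/
def integrableProjections : Submodule ℂ V :=
  (integrableFunctions χ s α).map (V.orthogonalProjectionOnto.toLinearMap ∘ₗ toInduced χ s μ α)

theorem dense_integrableProjections : Dense (integrableProjections V : Set V) := by
  rw [Submodule.dense_iff_topologicalClosure_eq_top, Submodule.topologicalClosure_eq_top_iff,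
    Submodule.eq_bot_iff]
  intro v hv
  rw [Submodule.mem_orthogonal] at hv
  have h : (v : InducedSpace χ s μ α) = 0 := by
    refine eq_zero_of_forall_inner_integrableFunctions fun f hf => ?_
    rw [← V.inner_orthogonalProjectionOnto_eq_of_mem_right]
    exact hv _ ⟨f, hf, rfl⟩
  exact_mod_cast h

variable {V}

theorem coefficient_orthogonalProjection
    (hinv : ∀ a : G, ∀ f ∈ V, inducedRep χ s μ α a f ∈ V) (F : InducedSpace χ s μ α) (v : V) :
    coefficient (inducedRep χ s μ α) (V.orthogonalProjectionOnto F) v =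
      coefficient (inducedRep χ s μ α) F v := by
  ext g
  rw [coefficient, coefficient, inner_map_eq_inner_map_inv, inner_map_eq_inner_map_inv]
  exact V.inner_orthogonalProjectionOnto_eq_of_mem_right ⟨_, hinv g⁻¹ v v.2⟩ F

variable [α.IsInvInvariant]

theorem exists_norm_coefficient_le
    (hinv : ∀ a : G, ∀ f ∈ V, inducedRep χ s μ α a f ∈ V) {u : V}
    (hu : u ∈ integrableProjections V) :
    ∃ C : ℝ, ∀ v : V, ∃ h : coefficient (inducedRep χ s μ α) (u : InducedSpace χ s μ α) v ∈
      inducedFunctions χ s α, ‖toInduced χ s μ α ⟨_, h⟩‖ ≤ C * ‖v‖ := by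
  obtain ⟨f, hf, hfu⟩ := hu
  have hc : ∀ v : V, coefficient (inducedRep χ s μ α) (u : InducedSpace χ s μ α) v =
      coefficient (inducedRep χ s μ α) (toInduced χ s μ α f) v := fun v => by
    rw [← coefficient_orthogonalProjection hinv (toInduced χ s μ α f), ← hfu]
    rfl
  have hmem : ∀ v : V, coefficient (inducedRep χ s μ α) (u : InducedSpace χ s μ α) v ∈
      inducedFunctions χ s α := fun v => (hc v).symm ▸ coefficient_mem_of_integrable hf _
  refine ⟨(∫⁻ x, ‖(f : G → ℂ) (s.toFun x)‖ₑ ∂α).toReal, fun v => ⟨hmem v, ?_⟩⟩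
  have heq : (⟨_, hmem v⟩ : inducedFunctions χ s α) = ⟨_, coefficient_mem_of_integrable hf _⟩ :=
    Subtype.ext (hc v)
  rw [heq]
  exact norm_coefficient_le hf _

/-- For fixed `u`, the map `v ↦ c_{u,v}` intertwines the subrepresentation on `V` with left
translation, so that Schur's lemma makes it a multiple of an isometry. -/
theorem exists_norm_sq_coefficient_eq
    (hinv : ∀ a : G, ∀ f ∈ V, inducedRep χ s μ α a f ∈ V)
    (hirr : IsIrreducible (restrict (inducedRep χ s μ α) V hinv)) {u : V}
    (hu : u ∈ integrableProjections V) :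
    ∃ c : ℝ, ∀ (v : V) (h : coefficient (inducedRep χ s μ α) (u : InducedSpace χ s μ α) v ∈
      inducedFunctions χ s α), ‖toInduced χ s μ α ⟨_, h⟩‖ ^ 2 = c * ‖v‖ ^ 2 := by
  obtain ⟨C, hC⟩ := exists_norm_coefficient_le hinv hu
  choose hmem hle using hC
  let T : V →L[ℂ] InducedSpace χ s μ α := LinearMap.mkContinuous
    { toFun := fun v => toInduced χ s μ α ⟨_, hmem v⟩
      map_add' := fun v w => by
        rw [← map_add]
        congr 1
        ext g
        exact inner_add_right _ _ _
      map_smul' := fun c v => by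
        rw [RingHom.id_apply, ← map_smul]
        congr 1
        ext g
        exact inner_smul_right _ _ _ } C hle
  obtain ⟨c, hc⟩ := hirr.exists_norm_sq_eq (inducedRep χ s μ α) T fun a v => by
    change toInduced χ s μ α ⟨_, hmem _⟩ = toInduced χ s μ α (leftTranslate χ s α a ⟨_, hmem _⟩)
    congr 1
    ext g
    change inner ℂ (inducedRep χ s μ α g u) (inducedRep χ s μ α a v) =
      inner ℂ (inducedRep χ s μ α (a⁻¹ * g) u) (v : InducedSpace χ s μ α)
    have h : inducedRep χ s μ α (a⁻¹ * g) (u : InducedSpace χ s μ α) =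
      inducedRep χ s μ α a⁻¹ (inducedRep χ s μ α g u) := by rw [map_mul]; rfl
    rw [h, inner_map_eq_inner_map_inv _ a⁻¹, inv_inv]
  exact ⟨c, fun v _ => hc v⟩

/-- The bound `‖c_{u,v}‖ ≤ K ‖u‖ ‖v‖` on the dense subspace of integrable
projections. As `‖c_{u,v}‖ = ‖c_{v,u}‖`, the Schur constant of `u` is found by comparison with
that of one fixed nonzero `u₀`. -/
theorem exists_eLpNorm_coefficient_le
    (hinv : ∀ a : G, ∀ f ∈ V, inducedRep χ s μ α a f ∈ V)
    (hirr : IsIrreducible (restrict (inducedRep χ s μ α) V hinv)) :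
    ∃ K : ℝ, ∀ u ∈ integrableProjections V, ∀ v : V,
      eLpNorm (fun x => coefficient (inducedRep χ s μ α) (u : InducedSpace χ s μ α) v
        (s.toFun x)) 2 α ≤ ENNReal.ofReal (K * ‖u‖ * ‖v‖) := by
  have := hirr.1
  obtain ⟨u₀, hu₀, hne⟩ : ∃ u₀ ∈ integrableProjections V, u₀ ≠ 0 := by
    by_contra! h
    have hd := dense_integrableProjections V
    rw [(Submodule.eq_bot_iff _).2 h] at hd
    obtain ⟨v, hv⟩ := exists_ne (0 : V)
    have : v ∈ closure ((⊥ : Submodule ℂ V) : Set V) := hd v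
    rw [Submodule.bot_coe, closure_singleton] at this
    exact hv this
  obtain ⟨c₀, hc₀⟩ := exists_norm_sq_coefficient_eq hinv hirr hu₀
  have hn₀ : ‖u₀‖ ^ 2 ≠ 0 := pow_ne_zero 2 (norm_ne_zero_iff.2 hne)
  refine ⟨√(c₀ / ‖u₀‖ ^ 2), fun u hu v => ?_⟩
  obtain ⟨C, hC⟩ := exists_norm_coefficient_le hinv hu
  obtain ⟨c, hc⟩ := exists_norm_sq_coefficient_eq hinv hirr hu
  obtain ⟨h0, -⟩ := hC u₀
  obtain ⟨hv, -⟩ := hC v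
  have hswap := coefficient_swap_mem h0
  have h1 : ‖toInduced χ s μ α ⟨_, h0⟩‖ = ‖toInduced χ s μ α ⟨_, hswap⟩‖ := by
    rw [norm_toInduced, norm_toInduced]
    exact congrArg ENNReal.toReal (eLpNorm_coefficient_swap h0).symm
  have h2 : c * ‖u₀‖ ^ 2 = c₀ * ‖u‖ ^ 2 := by rw [← hc u₀ h0, h1, hc₀ u hswap]
  have hcval : c = c₀ / ‖u₀‖ ^ 2 * ‖u‖ ^ 2 := by
    rw [div_mul_eq_mul_div, ← h2, mul_div_cancel_right₀ _ hn₀]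
  have h3 : ‖toInduced χ s μ α ⟨_, hv⟩‖ = √(c₀ / ‖u₀‖ ^ 2) * ‖u‖ * ‖v‖ := by
    rw [← Real.sqrt_sq (norm_nonneg (toInduced χ s μ α ⟨_, hv⟩)), hc v hv, hcval,
      Real.sqrt_mul' _ (sq_nonneg _), Real.sqrt_mul' _ (sq_nonneg _),
      Real.sqrt_sq (norm_nonneg _), Real.sqrt_sq (norm_nonneg _)]
  rw [← h3, norm_toInduced, ENNReal.ofReal_toReal hv.2.2.2.ne]

/-- Every coefficient is the pointwise limit of coefficients with uniformly bounded `L²`-norm, and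
Fatou's lemma applies. -/
theorem coefficient_mem_of_isIrreducible
    (hinv : ∀ a : G, ∀ f ∈ V, inducedRep χ s μ α a f ∈ V)
    (hirr : IsIrreducible (restrict (inducedRep χ s μ α) V hinv)) (u v : V) :
    coefficient (inducedRep χ s μ α) (u : InducedSpace χ s μ α) v ∈ inducedFunctions χ s α := by
  obtain ⟨K, hK⟩ := exists_eLpNorm_coefficient_le hinv hirr
  obtain ⟨w, hw, hlim⟩ := mem_closure_iff_seq_limit.1 (dense_integrableProjections V u)
  rw [coefficient_mem_iff]
  have hpt : ∀ x, Filter.Tendsto (fun n => coefficient (inducedRep χ s μ α)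
      (w n : InducedSpace χ s μ α) v (s.toFun x)) Filter.atTop
      (nhds (coefficient (inducedRep χ s μ α) (u : InducedSpace χ s μ α) v (s.toFun x))) := by
    intro x
    refine Filter.Tendsto.inner ?_ tendsto_const_nhds
    exact (((inducedRep χ s μ α (s.toFun x)).continuous.comp continuous_subtype_val).tendsto
      u).comp hlim
  have hbound : Filter.Tendsto (fun n => ENNReal.ofReal (K * ‖w n‖ * ‖v‖)) Filter.atTop
      (nhds (ENNReal.ofReal (K * ‖u‖ * ‖v‖))) :=
    ENNReal.tendsto_ofReal ((hlim.norm.const_mul K).mul_const ‖v‖)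
  refine (Lp.eLpNorm_lim_le_liminf_eLpNorm (fun n =>
    ((measurable_coefficient _ _).comp s.measurable_toFun).aestronglyMeasurable) _
    (Filter.Eventually.of_forall hpt)).trans_lt ?_
  calc _ ≤ Filter.liminf (fun n => ENNReal.ofReal (K * ‖w n‖ * ‖v‖)) Filter.atTop :=
        Filter.liminf_le_liminf (Filter.Eventually.of_forall fun n => hK (w n) (hw n) v)
    _ = ENNReal.ofReal (K * ‖u‖ * ‖v‖) := hbound.liminf_eq
    _ < ∞ := ENNReal.ofReal_lt_top

end SquareIntegrable

section RightTranslation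

variable {G : Type*} [Group G] [TopologicalSpace G] [IsTopologicalGroup G] [T2Space G]
  [LocallyCompactSpace G] [SecondCountableTopology G] [MeasurableSpace G] [BorelSpace G]
  {χ : Subgroup.center G →ₜ* Circle} {s : BorelSection G} {μ : Measure G}
  {α : Measure (G ⧸ Subgroup.center G)} [μ.IsHaarMeasure] [α.IsHaarMeasure]

/-! ### Right translation on the induced space -/

theorem apply_mul_center_mul (f : inducedFunctions χ s α) (g a : G) (h : Subgroup.center G) :
    (f : G → ℂ) (g * h * a) = (χ h⁻¹ : ℂ) * (f : G → ℂ) (g * a) := by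
  rw [mul_assoc, ← Subgroup.mem_center_iff.1 h.2 a, ← mul_assoc, f.2.2.1]

theorem eLpNorm_mul_right [α.IsMulRightInvariant] (f : inducedFunctions χ s α) (a : G) :
    eLpNorm (fun x => (f : G → ℂ) (s.toFun x * a)) 2 α =
      eLpNorm (fun x => (f : G → ℂ) (s.toFun x)) 2 α := by
  have h : ∀ x, ‖(f : G → ℂ) (s.toFun x * a)‖ =
      ‖((fun x => (f : G → ℂ) (s.toFun x)) ∘ fun x => x * (a : G ⧸ Subgroup.center G)) x‖ := by
    intro x
    rw [← norm_apply_section f.2, QuotientGroup.mk_mul, s.mk_toFun]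
    rfl
  rw [eLpNorm_congr_norm_ae (Filter.Eventually.of_forall h)]
  exact eLpNorm_comp_measurePreserving f.2.2.2.1 (measurePreserving_mul_right α _)

variable (χ s α) in
/-- Right translation `f ↦ f(· a)` on functions. It preserves covariance because the covariance
condition involves central elements only. -/
def rightTranslate [α.IsMulRightInvariant] (a : G) :
    inducedFunctions χ s α →ₗ[ℂ] inducedFunctions χ s α where
  toFun f := ⟨fun g => (f : G → ℂ) (g * a), f.2.1.comp (measurable_mul_const a),
    fun g h => apply_mul_center_mul f g a h,
    (f.2.1.comp ((measurable_mul_const a).comp s.measurable_toFun)).aestronglyMeasurable,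
    (eLpNorm_mul_right f a).trans_lt f.2.2.2.2⟩
  map_add' _ _ := rfl
  map_smul' _ _ := rfl

variable [μ.IsMulRightInvariant] [α.IsMulRightInvariant]

variable (χ s μ α) in
/-- Right translation on equivalence classes, as a linear isometry. -/
def rightTranslation (a : G) : InducedSpace χ s μ α →ₗᵢ[ℂ] InducedSpace χ s μ α where
  toLinearMap := (nullFunctions χ s μ α).mapQ (nullFunctions χ s μ α) (rightTranslate χ s α a)
    fun _ hf => (measurePreserving_mul_right μ a).quasiMeasurePreserving.ae_eq hf
  norm_map' F := by
    obtain ⟨f, rfl⟩ := toInduced_surjective F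
    change ‖toInduced χ s μ α (rightTranslate χ s α a f)‖ = _
    rw [norm_toInduced, norm_toInduced]
    exact congrArg ENNReal.toReal (eLpNorm_mul_right f a)

theorem rightTranslation_toInduced (a : G) (f : inducedFunctions χ s α) :
    rightTranslation χ s μ α a (toInduced χ s μ α f) =
      toInduced χ s μ α (rightTranslate χ s α a f) := rfl

theorem rightTranslation_inv_apply (a : G) (F : InducedSpace χ s μ α) :
    rightTranslation χ s μ α a⁻¹ (rightTranslation χ s μ α a F) = F := by
  obtain ⟨f, rfl⟩ := toInduced_surjective F
  rw [rightTranslation_toInduced, rightTranslation_toInduced]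
  congr 1
  ext g
  change (f : G → ℂ) (g * a⁻¹ * a) = _
  rw [inv_mul_cancel_right]

/-- Right translates of coefficients are coefficients: `c_{u,v}(ga) = c_{π(a)u,v}(g)`. -/
theorem rightTranslation_mem_coefficientSpace
    {E : Type*} [NormedAddCommGroup E] [InnerProductSpace ℂ E] (π : G →* (E ≃ₗᵢ[ℂ] E)) (a : G)
    {F : InducedSpace χ s μ α} (hF : F ∈ coefficientSpace χ s μ α π) :
    rightTranslation χ s μ α a F ∈ coefficientSpace χ s μ α π := by
  let M := (coefficientSpace χ s μ α π).comap (rightTranslation χ s μ α a).toLinearMap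
  have hM : IsClosed (M : Set (InducedSpace χ s μ α)) :=
    (Submodule.isClosed_topologicalClosure _).preimage (rightTranslation χ s μ α a).continuous
  refine Submodule.topologicalClosure_minimal _ (Submodule.span_le.2 ?_) hM hF
  rintro _ ⟨u, v, h, rfl⟩
  have hc : coefficient π (π a u) v = fun g => coefficient π u v (g * a) := by
    ext g
    rw [coefficient, coefficient, map_mul]
    rfl
  have hmem : coefficient π (π a u) v ∈ inducedFunctions χ s α := by
    rw [hc]
    exact (rightTranslate χ s α a ⟨_, h⟩).2
  refine Submodule.le_topologicalClosure _ (Submodule.subset_span ⟨π a u, v, hmem, ?_⟩)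
  exact congrArg (toInduced χ s μ α) (Subtype.ext hc.symm)

/-! ### The matrix coefficients of right translation -/

/-- The function `a ↦ ⟨w, R(a) f⟩`, where `R` is right translation. -/
def rightCoefficient (w f : inducedFunctions χ s α) (a : G) : ℂ :=
  ∫ x, (starRingEnd ℂ) ((w : G → ℂ) (s.toFun x)) * (f : G → ℂ) (s.toFun x * a) ∂α

theorem rightCoefficient_eq_inner (w f : inducedFunctions χ s α) (a : G) :
    rightCoefficient w f a =
      inner ℂ (toInduced χ s μ α w) (rightTranslation χ s μ α a (toInduced χ s μ α f)) :=
  (inner_toInduced w (rightTranslate χ s α a f)).symm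

theorem measurable_rightCoefficient (w f : inducedFunctions χ s α) :
    Measurable (rightCoefficient w f) := by
  refine (StronglyMeasurable.integral_prod_right' (f := fun q : G × (G ⧸ Subgroup.center G) =>
    (starRingEnd ℂ) ((w : G → ℂ) (s.toFun q.2)) * (f : G → ℂ) (s.toFun q.2 * q.1))
    (Measurable.stronglyMeasurable ?_)).measurable
  have hs : Measurable (fun q : G × (G ⧸ Subgroup.center G) => s.toFun q.2) :=
    s.measurable_toFun.comp measurable_snd
  exact (Complex.continuous_conj.measurable.comp (w.2.1.comp hs)).mul
    (f.2.1.comp (hs.mul measurable_fst))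

theorem rightCoefficient_mul_center (w f : inducedFunctions χ s α) (a : G)
    (h : Subgroup.center G) :
    rightCoefficient w f (a * h) = (χ h⁻¹ : ℂ) * rightCoefficient w f a := by
  rw [rightCoefficient, rightCoefficient, ← integral_const_mul]
  refine integral_congr_ae (Filter.Eventually.of_forall fun x => ?_)
  simp only [← mul_assoc, f.2.2.1]
  ring

variable (μ) in
theorem norm_rightCoefficient_le (w f : inducedFunctions χ s α) (a : G) :
    ‖rightCoefficient w f a‖ ≤ ‖toInduced χ s μ α w‖ * ‖toInduced χ s μ α f‖ := by
  rw [rightCoefficient_eq_inner (μ := μ)]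
  refine (norm_inner_le_norm _ _).trans_eq ?_
  rw [LinearIsometry.norm_map]

variable [α.IsInvInvariant]

theorem integrable_prod_section (w v : inducedFunctions χ s α) {f : inducedFunctions χ s α}
    (hf : f ∈ integrableFunctions χ s α) :
    Integrable (fun q : (G ⧸ Subgroup.center G) × (G ⧸ Subgroup.center G) =>
      (starRingEnd ℂ) ((w : G → ℂ) (s.toFun q.1)) *
        ((starRingEnd ℂ) ((f : G → ℂ) (s.toFun q.2)) *
          (v : G → ℂ) (s.toFun q.1 * s.toFun q.2))) (α.prod α) := by
  have hs := s.measurable_toFun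
  have hs1 : Measurable (fun q : (G ⧸ Subgroup.center G) × (G ⧸ Subgroup.center G) =>
    s.toFun q.1) := hs.comp measurable_fst
  have hs2 : Measurable (fun q : (G ⧸ Subgroup.center G) × (G ⧸ Subgroup.center G) =>
    s.toFun q.2) := hs.comp measurable_snd
  have hmeas : Measurable (fun q : (G ⧸ Subgroup.center G) × (G ⧸ Subgroup.center G) =>
      (starRingEnd ℂ) ((w : G → ℂ) (s.toFun q.1)) *
        ((starRingEnd ℂ) ((f : G → ℂ) (s.toFun q.2)) *
          (v : G → ℂ) (s.toFun q.1 * s.toFun q.2))) :=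
    (Complex.continuous_conj.measurable.comp (w.2.1.comp hs1)).mul
      ((Complex.continuous_conj.measurable.comp (f.2.1.comp hs2)).mul (v.2.1.comp (hs1.mul hs2)))
  refine ⟨hmeas.aestronglyMeasurable, ?_⟩
  let A : G ⧸ Subgroup.center G → ℝ≥0∞ := fun x => ‖(w : G → ℂ) (s.toFun x)‖ₑ
  let a : G ⧸ Subgroup.center G → ℝ≥0∞ := fun x => ‖(f : G → ℂ) (s.toFun x)‖ₑ
  let b : G ⧸ Subgroup.center G → ℝ≥0∞ := fun x => ‖(v : G → ℂ) (s.toFun x)‖ₑ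
  have hA : Measurable A := (w.2.1.comp hs).enorm
  have ha : Measurable a := (f.2.1.comp hs).enorm
  have hb : Measurable b := (v.2.1.comp hs).enorm
  let I : G ⧸ Subgroup.center G → ℝ≥0∞ := fun x => ∫⁻ y, a (x⁻¹ * y) * b y ∂α
  have hinner : ∀ x, ∫⁻ y, ‖(starRingEnd ℂ) ((w : G → ℂ) (s.toFun x)) *
      ((starRingEnd ℂ) ((f : G → ℂ) (s.toFun y)) * (v : G → ℂ) (s.toFun x * s.toFun y))‖ₑ ∂α =
      A x * I x := by
    intro x
    have h1 : ∀ y, ‖(starRingEnd ℂ) ((w : G → ℂ) (s.toFun x)) *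
        ((starRingEnd ℂ) ((f : G → ℂ) (s.toFun y)) * (v : G → ℂ) (s.toFun x * s.toFun y))‖ₑ =
        A x * (a (x⁻¹ * (x * y)) * b (x * y)) := fun y => by
      rw [enorm_mul, enorm_mul, RCLike.enorm_conj, RCLike.enorm_conj, ← enorm_apply_section v,
        QuotientGroup.mk_mul, s.mk_toFun, s.mk_toFun, inv_mul_cancel_left]
    simp_rw [h1]
    rw [lintegral_const_mul _ (by fun_prop),
      lintegral_mul_left_eq_self (fun y => a (x⁻¹ * y) * b y)]
  have hI : ∫⁻ x, I x ^ 2 ∂α < ∞ := by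
    refine (lintegral_convolution_sq_le α ha hb).trans_lt (ENNReal.mul_lt_top ?_ ?_)
    · exact ENNReal.pow_lt_top hf.2
    · rw [← eLpNorm_two_sq]
      exact ENNReal.pow_lt_top v.2.2.2.2
  -- the inner integral is a convolution, square integrable by Young's inequality
  have hle : ∀ t r : ℝ≥0∞, t * r ≤ t ^ 2 + r ^ 2 := fun t r => by
    rcases le_total t r with h | h
    · exact (mul_le_mul_left h r).trans ((sq r).symm.le.trans le_add_self)
    · exact (mul_le_mul_right h t).trans ((sq t).symm.le.trans le_self_add)
  rw [HasFiniteIntegral, lintegral_prod _ hmeas.enorm.aemeasurable]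
  simp only [hinner]
  refine (lintegral_mono fun x => hle (A x) (I x)).trans_lt ?_
  rw [lintegral_add_left (hA.pow_const 2)]
  refine ENNReal.add_lt_top.2 ⟨?_, hI⟩
  rw [← eLpNorm_two_sq]
  exact ENNReal.pow_lt_top w.2.2.2.2

/-- By Fubini's theorem, pairing with a coefficient `c_{f,v}` amounts to testing the function
`a ↦ ⟨w, R(a) v⟩` against `f`. -/
theorem inner_coefficient_eq (w v : inducedFunctions χ s α) {f : inducedFunctions χ s α}
    (hf : f ∈ integrableFunctions χ s α) :
    inner ℂ (toInduced χ s μ α w)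
      (toInduced χ s μ α ⟨_, coefficient_mem_of_integrable hf (toInduced χ s μ α v)⟩) =
      ∫ y, (starRingEnd ℂ) ((f : G → ℂ) (s.toFun y)) * rightCoefficient w v (s.toFun y) ∂α := by
  have hc : ∀ g : G, coefficient (inducedRep χ s μ α) (toInduced χ s μ α f)
      (toInduced χ s μ α v) g =
      ∫ y, (starRingEnd ℂ) ((f : G → ℂ) (s.toFun y)) * (v : G → ℂ) (g * s.toFun y) ∂α := by
    intro g
    rw [coefficient, inner_map_eq_inner_map_inv, inducedRep_toInduced, inner_toInduced]
    simp [leftTranslate]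
  rw [inner_toInduced]
  simp only [hc, ← integral_const_mul]
  rw [integral_integral_swap (integrable_prod_section w v hf)]
  refine integral_congr_ae (Filter.Eventually.of_forall fun y => ?_)
  simp only [rightCoefficient, ← integral_const_mul]
  refine integral_congr_ae (Filter.Eventually.of_forall fun x => ?_)
  ring

theorem ae_rightCoefficient_eq_zero {w v : inducedFunctions χ s α}
    (h : ∀ (f : inducedFunctions χ s α) (hf : f ∈ integrableFunctions χ s α),
      inner ℂ (toInduced χ s μ α w)
        (toInduced χ s μ α ⟨_, coefficient_mem_of_integrable hf (toInduced χ s μ α v)⟩) = 0) :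
    ∀ᵐ x ∂α, rightCoefficient w v (s.toFun x) = 0 := by
  refine ae_eq_zero_of_forall_integrableFunctions (χ := χ) (measurable_rightCoefficient w v)
    (rightCoefficient_mul_center w v) (fun E _ hE => ?_)
    fun f hf => (inner_coefficient_eq w v hf).symm.trans (h f hf)
  have : IsFiniteMeasure (α.restrict E) := ⟨by simpa using hE⟩
  exact MemLp.of_bound
    ((measurable_rightCoefficient w v).comp s.measurable_toFun).aestronglyMeasurable _
    (Filter.Eventually.of_forall fun x => norm_rightCoefficient_le μ w v (s.toFun x))

/-! ### The coefficients span a space containing the subrepresentation -/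

/-- If `w` is orthogonal to `M(σ)`, then `⟨w, R(a) v⟩ = 0` for almost every `a`. As `H^χ` is
separable, a single `a` serves all `w`, so that `R(a) v` lies in `M(σ)`, which is invariant under
right translations. -/
theorem le_coefficientSpace (V : Submodule ℂ (InducedSpace χ s μ α)) [CompleteSpace V]
    (hinv : ∀ a : G, ∀ f ∈ V, inducedRep χ s μ α a f ∈ V) :
    V ≤ coefficientSpace χ s μ α (restrict (inducedRep χ s μ α) V hinv) := by
  intro v hv
  set M := coefficientSpace χ s μ α (restrict (inducedRep χ s μ α) V hinv)
  have hMclosed : IsClosed (M : Set (InducedSpace χ s μ α)) :=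
    Submodule.isClosed_topologicalClosure _
  have : CompleteSpace M := hMclosed.completeSpace_coe
  obtain ⟨v, rfl⟩ := toInduced_surjective v
  have hcoeff : ∀ (f : inducedFunctions χ s α) (hf : f ∈ integrableFunctions χ s α),
      toInduced χ s μ α ⟨_, coefficient_mem_of_integrable hf (toInduced χ s μ α v)⟩ ∈ M := by
    intro f hf
    have hc := coefficient_orthogonalProjection hinv (toInduced χ s μ α f) ⟨_, hv⟩
    refine Submodule.le_topologicalClosure _ (Submodule.subset_span
      ⟨V.orthogonalProjectionOnto (toInduced χ s μ α f), ⟨_, hv⟩,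
        hc.symm ▸ coefficient_mem_of_integrable hf _, ?_⟩)
    exact congrArg (toInduced χ s μ α) (Subtype.ext hc.symm)
  have hae : ∀ w ∈ Mᗮ, ∀ᵐ x ∂α, inner ℂ w
      (rightTranslation χ s μ α (s.toFun x) (toInduced χ s μ α v)) = 0 := by
    intro w hw
    obtain ⟨w, rfl⟩ := toInduced_surjective w
    filter_upwards [ae_rightCoefficient_eq_zero (μ := μ) (w := w) (v := v) fun f hf =>
      (Submodule.mem_orthogonal' M _).1 hw _ (hcoeff f hf)] with x hx
    rw [← rightCoefficient_eq_inner, hx]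
  obtain ⟨S, hScount, hSdense⟩ := TopologicalSpace.exists_countable_dense Mᗮ
  obtain ⟨x, hx⟩ := ((ae_ball_iff hScount).2 fun w _ => hae w w.2).exists
  have hmem : rightTranslation χ s μ α (s.toFun x) (toInduced χ s μ α v) ∈ M := by
    rw [← M.orthogonal_orthogonal, Submodule.mem_orthogonal]
    have h := Continuous.ext_on hSdense
      (f := fun w : Mᗮ => inner ℂ (w : InducedSpace χ s μ α)
        (rightTranslation χ s μ α (s.toFun x) (toInduced χ s μ α v)))
      (continuous_subtype_val.inner continuous_const) continuous_const hx
    exact fun w hw => congrFun h ⟨w, hw⟩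
  rw [← rightTranslation_inv_apply (s.toFun x) (toInduced χ s μ α v)]
  exact rightTranslation_mem_coefficientSpace _ _ hmem

end RightTranslation

end CentralInduction

end

theorem mainTheorem2 {G : Type*} [Group G] [TopologicalSpace G] [IsTopologicalGroup G]
    [T2Space G] [LocallyCompactSpace G] [SecondCountableTopology G]
    [MeasurableSpace G] [BorelSpace G]
    (μ : MeasureTheory.Measure G) [μ.IsHaarMeasure] [μ.IsMulRightInvariant]
    (α : MeasureTheory.Measure (G ⧸ Subgroup.center G)) [α.IsHaarMeasure]
    (s : CentralInduction.BorelSection G) (χ : Subgroup.center G →ₜ* Circle)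
    (V : Submodule ℂ (CentralInduction.InducedSpace χ s μ α))
    (hclosed : IsClosed (V : Set (CentralInduction.InducedSpace χ s μ α)))
    (hinv : ∀ a : G, ∀ f ∈ V, CentralInduction.inducedRep χ s μ α a f ∈ V)
    (hirr : CentralInduction.IsIrreducible
      (CentralInduction.restrict (CentralInduction.inducedRep χ s μ α) V hinv)) :
    (∀ u v : V, CentralInduction.coefficient
        (CentralInduction.restrict (CentralInduction.inducedRep χ s μ α) V hinv) u v ∈
          CentralInduction.inducedFunctions χ s α) ∧
      V ≤ CentralInduction.coefficientSpace χ s μ α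
        (CentralInduction.restrict (CentralInduction.inducedRep χ s μ α) V hinv) := by
  have : α.IsMulRightInvariant := CentralInduction.isMulRightInvariant_quotient_center μ α
  have : α.IsInvInvariant := CentralInduction.isInvInvariant_of_isMulRightInvariant α
  have : CompleteSpace V := hclosed.completeSpace_coe
  exact ⟨CentralInduction.coefficient_mem_of_isIrreducible hinv hirr,
    CentralInduction.le_coefficientSpace V hinv⟩
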